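/- **Theorem C (coconvex Brion theorem).** Let $C\subset\mathbb R^d$ be an integer cone, that is, $C=\{t_1v_1+\dots+t_nv_n \mid t_i\ge 0\}$ for some $v_1,\dots,v_n\in\mathbb Z^d$, and assume that $C$ (a closed cone with apex $0$) is strictly convex (i.e. $C\cap(-C)=\{0\}$) and has nonempty interior. Let $A$ be a $C$-coconvex integer polytope, that is, $A=C\setminus(\Delta\cup\{0\})$, where $\Delta\subset C$ is a closed convex set such that $C\setminus\Delta$ is bounded and nonempty and all vertices of $\Delta$ belong to $\mathbb Z^d$. For $X\subset\mathbb R^d$ let $G(X)=\sum_{a\in X\cap\mathbb Z^d}x^a$ be the generating function for the integer points in $X$, regarded as a rational function of $x_1,\dots,x_d$: $G(X)=p/q$ if $p$ and $q\ne0$ are Laurent polynomials over $\mathbb Q$ with $q\cdot\sum_{a\in X\cap\mathbb Z^d}x^a=p$ as formal series (such a quotient $p/q$ is unique if it exists, and is the usual finite sum if $X\cap\mathbb Z^d$ is finite). Let $\mathrm{vert}(A)$ be the set of vertices of the (in general neither convex nor closed) polyhedral set $A$: the points of $\overline A$ near which $A$ is not translation invariant in any direction $v\neq0$. Then $\mathrm{vert}(A)\setminus\{0\}$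 is a finite subset of $\mathbb Z^d$; for every $a\in\mathrm{vert}(A)\setminus\{0\}$ there is a cone $C'_a$ with the apex at $0$ such that a small neighborhood of $0$ in $C'_a$ coincides with a small neighborhood of $0$ in $\overline{C\setminus A}-a$; the rational functions $G(A)$, $G(C)$ and $G(C'_a)$ are well defined; and $$G(A)=-\sum_{a\in\mathrm{vert}(A)\setminus\{0\}}x^a\,G(C'_a)+G(C)-1 .$$ -/

import Mathlib

open Filter Topology

noncomputable section

namespace Coconvex

/-- The integer vector `a ∈ ℤ^d`, seen as a point of `ℝ^d`. -/
def intVec {d : ℕ} (a : Fin d → ℤ) : Fin d → ℝ := fun i => (a i : ℝ)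

/-! ### Rational functions and generating functions -/

/-- Laurent polynomials in `x_1, …, x_d` over `ℚ`: finite combinations of the monomials `x^a`,
`a ∈ ℤ^d`. -/
abbrev Laurent (d : ℕ) : Type := AddMonoidAlgebra ℚ (Fin d → ℤ)

/-- The field `ℚ(x_1, …, x_d)` of rational functions, as the field of fractions of the ring of
Laurent polynomials. -/
abbrev RatFun (d : ℕ) : Type := FractionRing (Laurent d)

/-- The monomial `x^a`, as a rational function. -/
def mono {d : ℕ} (a : Fin d → ℤ) : RatFun d :=
  algebraMap (Laurent d) (RatFun d) (AddMonoidAlgebra.single a 1)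

/-- The coefficients of the formal (two-sided infinite) series `∑ x^a`, the sum being over all
integer points `a` of `X`. -/
def indicatorSeries {d : ℕ} (X : Set (Fin d → ℝ)) : (Fin d → ℤ) → ℚ :=
  (intVec ⁻¹' X).indicator 1

/-- The product of a Laurent polynomial `q` and a formal series `∑ f(n) x^n`. -/
def mulSeries {d : ℕ} (q : Laurent d) (f : (Fin d → ℤ) → ℚ) : (Fin d → ℤ) → ℚ :=
  fun n => q.coeff.sum fun m c => c * f (n - m)

/-- The series `∑_{a ∈ X ∩ ℤ^d} x^a` sums to the rational function `r`: there are Laurent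
polynomials `p` and `q ≠ 0` such that `q · ∑_{a ∈ X ∩ ℤ^d} x^a = p` as formal series and
`r = p / q`. -/
def HasGenFun {d : ℕ} (X : Set (Fin d → ℝ)) (r : RatFun d) : Prop :=
  ∃ p q : Laurent d, q ≠ 0 ∧ mulSeries q (indicatorSeries X) = p.coeff ∧
    r = algebraMap (Laurent d) (RatFun d) p / algebraMap (Laurent d) (RatFun d) q

open Classical in
/-- The generating function `G(X)` for the integer points in `X` (zero if the series is not the
expansion of a rational function). -/
def genFun {d : ℕ} (X : Set (Fin d → ℝ)) : RatFun d :=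
  if h : ∃ r, HasGenFun X r then h.choose else 0

theorem mulSeries_single {d : ℕ} (a : Fin d → ℤ) (c : ℚ) (f : (Fin d → ℤ) → ℚ) (n : Fin d → ℤ) :
    mulSeries (AddMonoidAlgebra.single a c) f n = c * f (n - a) := by
  simp [mulSeries]

theorem mulSeries_add {d : ℕ} (p q : Laurent d) (f : (Fin d → ℤ) → ℚ) :
    mulSeries (p + q) f = mulSeries p f + mulSeries q f := by
  funext n
  simp only [mulSeries, Pi.add_apply, AddMonoidAlgebra.coeff_add]
  exact Finsupp.sum_add_index' (fun _ => zero_mul _) (fun _ _ _ => add_mul _ _ _)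

theorem mulSeries_add_right {d : ℕ} (p : Laurent d) (f g : (Fin d → ℤ) → ℚ) :
    mulSeries p (f + g) = mulSeries p f + mulSeries p g := by
  funext n
  simp only [mulSeries, Pi.add_apply, mul_add, Finsupp.sum_add]

theorem mulSeries_zero {d : ℕ} (f : (Fin d → ℤ) → ℚ) : mulSeries (0 : Laurent d) f = 0 := by
  funext n
  simp [mulSeries]

theorem mulSeries_mul {d : ℕ} (p q : Laurent d) (f : (Fin d → ℤ) → ℚ) :
    mulSeries (p * q) f = mulSeries p (mulSeries q f) := by
  induction p using AddMonoidAlgebra.induction_linear with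
  | zero => simp [mulSeries_zero]
  | add p p' hp hp' => rw [add_mul, mulSeries_add, mulSeries_add, hp, hp']
  | single a c =>
    induction q using AddMonoidAlgebra.induction_linear with
    | zero =>
      funext n
      rw [mulSeries_single, mul_zero, mulSeries_zero]
      simp
    | add q q' hq hq' =>
      rw [mul_add, mulSeries_add, mulSeries_add, hq, hq', mulSeries_add_right]
    | single b e =>
      funext n
      rw [AddMonoidAlgebra.single_mul_single, mulSeries_single, mulSeries_single, mulSeries_single,
        mul_assoc, sub_sub]

theorem mulSeries_coeff {d : ℕ} (p q : Laurent d) : mulSeries p q.coeff = (p * q).coeff := by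
  induction p using AddMonoidAlgebra.induction_linear with
  | zero => simp [mulSeries_zero]
  | add p p' hp hp' => rw [add_mul, mulSeries_add, hp, hp', AddMonoidAlgebra.coeff_add]; rfl
  | single a c =>
    induction q using AddMonoidAlgebra.induction_linear with
    | zero =>
      funext n
      rw [mulSeries_single]
      simp
    | add q q' hq hq' =>
      rw [mul_add, AddMonoidAlgebra.coeff_add, AddMonoidAlgebra.coeff_add, Finsupp.coe_add,
        mulSeries_add_right, hq, hq']
      rfl
    | single b e =>
      classical
      funext n
      rw [AddMonoidAlgebra.single_mul_single, mulSeries_single, AddMonoidAlgebra.coeff_single,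
        AddMonoidAlgebra.coeff_single, Finsupp.single_apply, Finsupp.single_apply, mul_ite, mul_zero]
      simp only [eq_sub_iff_add_eq, add_comm]

/-- The rational function that a series sums to is unique. -/
theorem HasGenFun.unique {d : ℕ} {X : Set (Fin d → ℝ)} {r r' : RatFun d}
    (h : HasGenFun X r) (h' : HasGenFun X r') : r = r' := by
  obtain ⟨p, q, hq, hpq, rfl⟩ := h
  obtain ⟨p', q', hq', hpq', rfl⟩ := h'
  have h1 : mulSeries (q' * q) (indicatorSeries X) = (q' * p).coeff := by
    rw [mulSeries_mul, hpq, mulSeries_coeff]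
  have h2 : mulSeries (q' * q) (indicatorSeries X) = (q * p').coeff := by
    rw [mul_comm, mulSeries_mul, hpq', mulSeries_coeff]
  have h3 : q' * p = q * p' := AddMonoidAlgebra.ext (DFunLike.coe_injective (h1.symm.trans h2))
  have inj := IsFractionRing.injective (Laurent d) (RatFun d)
  rw [div_eq_div_iff ((map_ne_zero_iff _ inj).2 hq) ((map_ne_zero_iff _ inj).2 hq'), ← map_mul,
    ← map_mul, mul_comm p, h3, mul_comm]

theorem HasGenFun.genFun_eq {d : ℕ} {X : Set (Fin d → ℝ)} {r : RatFun d} (h : HasGenFun X r) :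
    genFun X = r := by
  have h' : ∃ r, HasGenFun X r := ⟨r, h⟩
  rw [genFun, dif_pos h']
  exact h'.choose_spec.unique h

/-- If `X` contains finitely many integer points, then `G(X)` is the finite sum of the monomials
`x^a` over these points. -/
theorem genFun_eq_sum {d : ℕ} {X : Set (Fin d → ℝ)} (S : Finset (Fin d → ℤ))
    (hS : ∀ a, a ∈ S ↔ intVec a ∈ X) : genFun X = ∑ a ∈ S, mono a := by
  classical
  apply HasGenFun.genFun_eq
  refine ⟨∑ a ∈ S, AddMonoidAlgebra.single a 1, 1, one_ne_zero, ?_, ?_⟩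
  · funext n
    rw [AddMonoidAlgebra.one_def, mulSeries_single]
    simp [indicatorSeries, Set.indicator_apply, Finsupp.single_apply, hS]
  · simp [mono]

/-! ### Cones, vertices, coconvex polytopes -/

/-- An integer cone: the set of all combinations `t_1 v_1 + ⋯ + t_n v_n`, `t_i ≥ 0`, of finitely
many integer vectors. -/
def IsIntegerCone {d : ℕ} (C : PointedCone ℝ (Fin d → ℝ)) : Prop :=
  ∃ s : Finset (Fin d → ℤ), C = PointedCone.hull ℝ (intVec '' (s : Set (Fin d → ℤ)))

/-- `A` is a `C`-coconvex integer polytope: `A = C ∖ (Δ ∪ {0})` for a closed convex subset `Δ` of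
`C` such that `C ∖ Δ` is bounded and nonempty, and all vertices (extreme points) of `Δ` are integer.
(When `C` is a pointed integer cone, such a `Δ` is automatically a polyhedron, since it has only
finitely many extreme points and is the Minkowski sum of their convex hull and `C`.) -/
def IsCoconvexIntegerPolytope {d : ℕ} (C : PointedCone ℝ (Fin d → ℝ)) (A : Set (Fin d → ℝ)) :
    Prop :=
  ∃ Δ : Set (Fin d → ℝ), Δ ⊆ C ∧ IsClosed Δ ∧ Convex ℝ Δ ∧
    Bornology.IsBounded ((C : Set (Fin d → ℝ)) \ Δ) ∧ ((C : Set (Fin d → ℝ)) \ Δ).Nonempty ∧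
    Δ.extremePoints ℝ ⊆ Set.range intVec ∧ A = (C : Set (Fin d → ℝ)) \ (Δ ∪ {0})

/-- The vertices of a polyhedral set `X`, which need be neither convex nor closed: the points `a` of
the closure of `X` such that there is no direction `v ≠ 0` in which `X` is translation invariant
near `a`. (If `X` is a convex polyhedron, these are its vertices in the usual sense.) -/
def vert {d : ℕ} (X : Set (Fin d → ℝ)) : Set (Fin d → ℝ) :=
  {a | a ∈ closure X ∧ ∀ v : Fin d → ℝ, v ≠ 0 →
    ¬ ∃ U ∈ 𝓝 a, ∀ x ∈ U, ∀ t : ℝ, x + t • v ∈ U → (x ∈ X ↔ x + t • v ∈ X)}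

/-- The tangent cone of `S` at `a`, with the apex at `0`: all `v` such that `a + t v` is in `S`
for all sufficiently small `t > 0`. If some cone with the apex at `0` coincides with `S - a` near
`0`, then it is this one. -/
def tangentCone {d : ℕ} (S : Set (Fin d → ℝ)) (a : Fin d → ℝ) : Set (Fin d → ℝ) :=
  {v | ∀ᶠ t : ℝ in 𝓝[>] 0, a + t • v ∈ S}

end Coconvex

end

/-!
The complement of `A` in `C` is `Δ ∪ {0}`, and `0 ∉ Δ`. So the formula says that the generating
function of `Δ` is the sum, over the extreme points `v` of `Δ`, of `x^v` times the generating
function of the tangent cone of `Δ` at `v`. This is Brion's theorem for `Δ`. It applies because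
`Δ = conv E + C`, where `E` is the set of the extreme points of `Δ`
(`exists_mem_convexHull_extremePoints`); `E` is finite, being a set of integer points in the closure
of the bounded set `C ∖ Δ`.

Brion's theorem is proved without the face lattice of `Δ`. Series annihilated by a nonzero Laurent
polynomial sum to `0`; among them are the series of all sets that are invariant under translations
by an integer vector `u ≠ 0`. For convex `P`, the sets `P + ℝ≥0 u` and `P - ℝ≥0 u` meet in `P`, and
their union is the invariant set `P + ℝ u`. So, up to torsion, the series of `P` is the sum of the
series of `P + ℝ≥0 u` and of `P - ℝ≥0 u` (`indicatorSeries_addCone_split`). Apply this to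
`conv E + Q` and to all `v + cone (E - v) + Q`, `v ∈ E`, for a cone `Q` that starts as `C`,
letting `u` run through the differences of the points of `E`. In the end `Q` contains each of these
differences up to sign, hence defines a total preorder on `E`. If `v` is a least point, then
`conv E + Q` is `v + Q`, which is the term of `v`, and the terms of all other points contain lines
(`brion_of_total`).

Finitely generated cones, and sums of such cones and polytopes, are given by finitely many
inequalities (`exists_dual_hull`, `exists_dual_convexHull_add_hull`). This yields the local
structure of `Δ` and `C` at a point: the vertices of `A` other than `0` are the points of `E`
(`mem_extremePoints_iff_forall_not_locallyInvariant`), and `Δ` coincides with its tangent cone near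
each of them. It also yields the rationality of the generating functions of integer cones
(`exists_hasGenFun_hull`).
-/

noncomputable section

namespace Coconvex

/-! ### Finitely generated cones and polyhedra as intersections of half-spaces -/

section Polyhedra
variable {V : Type*} [AddCommGroup V] [Module ℝ V]

/-- Fourier–Motzkin elimination: the sum of the cone `{l ≥ 0 | l ∈ L}` and the ray through `u` is
again given by finitely many inequalities, namely the `l ∈ L` with `0 ≤ l u`, and, for
all `l, m ∈ L` with `l u < 0 < m u`, the positive combination of `l` and `m` that vanishes at `u`. -/
theorem exists_dual_add_ray (L : Finset (Module.Dual ℝ V)) (u : V) :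
    ∃ L' : Finset (Module.Dual ℝ V), ∀ x,
      (∀ l ∈ L', 0 ≤ l x) ↔ ∃ t : ℝ, 0 ≤ t ∧ ∀ l ∈ L, 0 ≤ l (x - t • u) := by
  classical
  refine ⟨L.filter (fun l => 0 ≤ l u) ∪
    ((L.filter fun l => l u < 0) ×ˢ (L.filter fun l => 0 < l u)).image
      (fun p => p.2 u • p.1 - p.1 u • p.2), fun x => ⟨fun h => ?_, ?_⟩⟩
  · -- the admissible `t` form an interval; its left end is the largest of `0` and the `l x / l u`
    set f : Module.Dual ℝ V → ℝ := fun l => l x / l u with hf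
    have hne : (insert 0 ((L.filter fun l => l u < 0).image f)).Nonempty :=
      Finset.insert_nonempty _ _
    set t := Finset.max' _ hne with ht
    have ht0 : 0 ≤ t := Finset.le_max' _ _ (Finset.mem_insert_self _ _)
    refine ⟨t, ht0, fun l hl => ?_⟩
    rw [map_sub, map_smul, smul_eq_mul, sub_nonneg]
    rcases lt_trichotomy (l u) 0 with hu | hu | hu
    · have : f l ≤ t := Finset.le_max' _ (f l) <| Finset.mem_insert_of_mem <|
        Finset.mem_image_of_mem _ (Finset.mem_filter.2 ⟨hl, hu⟩)
      rwa [div_le_iff_of_neg hu] at this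
    · rw [hu, mul_zero]
      exact h l (Finset.mem_union_left _ (Finset.mem_filter.2 ⟨hl, hu.ge⟩))
    · rw [← le_div_iff₀ hu]
      refine Finset.max'_le _ _ _ fun y hy => ?_
      rcases Finset.mem_insert.1 hy with rfl | hy
      · exact div_nonneg (h l (Finset.mem_union_left _ (Finset.mem_filter.2 ⟨hl, hu.le⟩))) hu.le
      · obtain ⟨m, hm, rfl⟩ := Finset.mem_image.1 hy
        have hm' := (Finset.mem_filter.1 hm).2
        have := h _ (Finset.mem_union_right _ (Finset.mem_image_of_mem _
          (Finset.mk_mem_product hm (Finset.mem_filter.2 ⟨hl, hu⟩))))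
        simp only [LinearMap.sub_apply, LinearMap.smul_apply, smul_eq_mul] at this
        rw [div_le_iff_of_neg hm', div_mul_eq_mul_div, div_le_iff₀ hu]
        linarith
  · rintro ⟨t, ht, h⟩ l hl
    rcases Finset.mem_union.1 hl with hl | hl
    · obtain ⟨hl, hu⟩ := Finset.mem_filter.1 hl
      have := h l hl
      rw [map_sub, map_smul, smul_eq_mul] at this
      nlinarith [mul_nonneg ht hu]
    · obtain ⟨⟨m, n⟩, hmn, rfl⟩ := Finset.mem_image.1 hl
      obtain ⟨hm, hn⟩ := Finset.mem_product.1 hmn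
      obtain ⟨hm, hmu⟩ := Finset.mem_filter.1 hm
      obtain ⟨hn, hnu⟩ := Finset.mem_filter.1 hn
      have h1 := mul_nonneg hnu.le (h m hm)
      have h2 := mul_nonneg (neg_nonneg.2 hmu.le) (h n hn)
      simp only [map_sub, map_smul, smul_eq_mul] at h1 h2
      simp only [LinearMap.sub_apply, LinearMap.smul_apply, smul_eq_mul]
      linarith

/-- The Minkowski–Weyl theorem: a finitely generated cone is a finite intersection of
half-spaces. -/
theorem exists_dual_hull [FiniteDimensional ℝ V] (s : Finset V) :
    ∃ L : Finset (Module.Dual ℝ V), ∀ x,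
      x ∈ PointedCone.hull ℝ (s : Set V) ↔ ∀ l ∈ L, 0 ≤ l x := by
  classical
  induction s using Finset.induction_on with
  | empty =>
    let b := Module.finBasis ℝ V
    refine ⟨Finset.univ.image b.coord ∪ Finset.univ.image (fun i => -b.coord i), fun x => ?_⟩
    simp only [Finset.coe_empty, PointedCone.hull, Submodule.span_empty, Submodule.mem_bot]
    refine ⟨fun h l _ => by simp [h], fun h => b.ext_elem fun i => ?_⟩
    have h1 := h _ (Finset.mem_union_left _ (Finset.mem_image_of_mem _ (Finset.mem_univ i)))
    have h2 := h _ (Finset.mem_union_right _ (Finset.mem_image_of_mem _ (Finset.mem_univ i)))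
    simp only [Module.Basis.coord_apply, LinearMap.neg_apply] at h1 h2
    simp only [map_zero, Finsupp.coe_zero, Pi.zero_apply]
    linarith
  | insert u s _ ih =>
    obtain ⟨L, hL⟩ := ih
    obtain ⟨L', hL'⟩ := exists_dual_add_ray L u
    refine ⟨L', fun x => ?_⟩
    rw [hL', Finset.coe_insert, PointedCone.hull, Submodule.mem_span_insert]
    constructor
    · rintro ⟨a, z, hz, rfl⟩
      exact ⟨a, a.2, (hL _).1 (by convert hz using 1; exact add_sub_cancel_left _ _)⟩
    · rintro ⟨t, ht, h⟩
      exact ⟨⟨t, ht⟩, x - t • u, (hL _).2 h, (add_sub_cancel _ _).symm⟩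

theorem mem_hull_image_finset {ι : Type*} {s : Finset ι} {f : ι → V} {x : V} :
    x ∈ PointedCone.hull ℝ (f '' (s : Set ι)) ↔
      ∃ c : ι → ℝ, (∀ i ∈ s, 0 ≤ c i) ∧ ∑ i ∈ s, c i • f i = x := by
  rw [PointedCone.hull, Submodule.mem_span_image_finset_iff_exists_fun']
  constructor
  · rintro ⟨c, hc⟩
    exact ⟨fun i => c i, fun i _ => (c i).2, hc⟩
  · rintro ⟨c, h0, hc⟩
    refine ⟨fun i => ⟨max (c i) 0, le_max_right _ _⟩, hc ▸ Finset.sum_congr rfl fun i hi => ?_⟩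
    exact congrArg (· • f i) (max_eq_left (h0 i hi))

/-- The sum of a polytope and a finitely generated cone is a finite intersection of affine
half-spaces. It is the section at height `1` of the cone in `V × ℝ` generated by `E × {1}` and
`s × {0}`. -/
theorem exists_dual_convexHull_add_hull [FiniteDimensional ℝ V] (E s : Finset V) :
    ∃ L : Finset (Module.Dual ℝ V × ℝ), ∀ x,
      (∃ y ∈ convexHull ℝ (E : Set V), x - y ∈ PointedCone.hull ℝ (s : Set V)) ↔
        ∀ l ∈ L, 0 ≤ l.1 x + l.2 := by
  classical
  obtain ⟨L, hL⟩ := exists_dual_hull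
    (E.image (fun e => (e, (1 : ℝ))) ∪ s.image (fun u => (u, (0 : ℝ))))
  refine ⟨L.image fun l => (l ∘ₗ LinearMap.inl ℝ V ℝ, l (0, 1)), fun x => ?_⟩
  rw [Finset.forall_mem_image]
  have key : ∀ l : Module.Dual ℝ (V × ℝ), l (x, 1) = l (x, 0) + l (0, 1) := fun l => by
    rw [← map_add]; simp
  simp only [LinearMap.comp_apply, LinearMap.inl_apply, ← key]
  rw [← hL, Finset.coe_union, Finset.coe_image, Finset.coe_image]
  simp only [PointedCone.hull, Submodule.span_union, Submodule.mem_sup]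
  constructor
  · rintro ⟨y, hy, hc⟩
    rw [Finset.mem_convexHull'] at hy
    obtain ⟨w, hw, h1, rfl⟩ := hy
    refine ⟨(∑ e ∈ E, w e • e, 1), ?_, (x - ∑ e ∈ E, w e • e, 0), ?_, by simp⟩
    · refine (mem_hull_image_finset (f := fun e => (e, (1 : ℝ)))).2
        ⟨w, hw, ?_⟩
      ext <;> simp [Prod.fst_sum, Prod.snd_sum, h1]
    · nth_rw 1 [← Set.image_id (s : Set V)] at hc
      obtain ⟨c, h0, hc⟩ := mem_hull_image_finset.1 hc
      refine (mem_hull_image_finset (f := fun e => (e, (0 : ℝ)))).2 ⟨c, h0, ?_⟩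
      ext
      · simpa [Prod.fst_sum] using hc
      · simp [Prod.snd_sum]
  · rintro ⟨a, ha, b, hb, hab⟩
    obtain ⟨c, hc, rfl⟩ := (mem_hull_image_finset (f := fun e => (e, (1 : ℝ)))).1 ha
    obtain ⟨c', hc', rfl⟩ := (mem_hull_image_finset (f := fun e => (e, (0 : ℝ)))).1 hb
    have h1 := congrArg Prod.fst hab
    have h2 := congrArg Prod.snd hab
    simp [Prod.fst_sum, Prod.snd_sum] at h1 h2
    refine ⟨∑ e ∈ E, c e • e, (convex_convexHull ℝ _).sum_mem hc h2
      fun i hi => subset_convexHull ℝ _ hi, ?_⟩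
    rw [← h1, add_sub_cancel_left]
    nth_rw 1 [← Set.image_id (s : Set V)]
    exact mem_hull_image_finset.2 ⟨c', hc', by simp⟩

end Polyhedra

/-! ### Convex sets with bounded complement in a cone -/

section BoundedComplement
variable {V : Type*} [NormedAddCommGroup V] [NormedSpace ℝ V]
  {C : PointedCone ℝ V} {Δ : Set V}

/-- `C` is contained in the recession cone of `Δ`: far out, the ray from `x` in the direction `c` is
in `Δ`, hence, by convexity, all of it. -/
theorem add_mem_of_isBounded_diff (hΔC : Δ ⊆ C) (hconv : Convex ℝ Δ)
    (hbdd : Bornology.IsBounded ((C : Set V) \ Δ)) {x c : V} (hx : x ∈ Δ) (hc : c ∈ C) :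
    x + c ∈ Δ := by
  rcases eq_or_ne c 0 with rfl | hc0
  · rwa [add_zero]
  obtain ⟨R, hR⟩ := hbdd.exists_norm_le
  have hcpos : 0 < ‖c‖ := norm_pos_iff.2 hc0
  set t : ℝ := 1 + (|R| + ‖x‖) / ‖c‖ with ht
  have ht1 : 1 ≤ t := le_add_of_nonneg_right (by positivity)
  have ht0 : 0 < t := by linarith
  have hmem : x + t • c ∈ Δ := by
    by_contra hcon
    have h1 := hR _ ⟨add_mem (hΔC hx) (C.smul_mem ht0.le hc), hcon⟩
    have h2 : ‖t • c‖ ≤ ‖x + t • c‖ + ‖x‖ := by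
      simpa using norm_sub_le (x + t • c) x
    have h3 : ‖t • c‖ = ‖c‖ + |R| + ‖x‖ := by
      rw [norm_smul, Real.norm_of_nonneg ht0.le, ht, add_mul, div_mul_cancel₀ _ hcpos.ne']
      ring
    linarith [le_abs_self R]
  have := hconv hx hmem (a := 1 - 1 / t) (b := 1 / t)
    (sub_nonneg.2 ((div_le_one ht0).2 ht1)) (by positivity) (by ring)
  convert this using 1
  rw [smul_add, smul_smul, one_div_mul_cancel ht0.ne', one_smul, ← add_assoc, ← add_smul]
  simp

theorem zero_notMem_of_isBounded_diff (hΔC : Δ ⊆ C) (hconv : Convex ℝ Δ)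
    (hbdd : Bornology.IsBounded ((C : Set V) \ Δ)) (hne : ((C : Set V) \ Δ).Nonempty) :
    (0 : V) ∉ Δ := fun h0 => by
  obtain ⟨x, hxC, hx⟩ := hne
  exact hx (by simpa using add_mem_of_isBounded_diff hΔC hconv hbdd h0 hxC)

/-- The sum of the inequalities that define a salient cone is positive away from its apex. -/
theorem exists_dual_pos (hC : (C : ConvexCone ℝ V).Salient) {L : Finset (Module.Dual ℝ V)}
    (hL : ∀ x, x ∈ C ↔ ∀ l ∈ L, 0 ≤ l x) :
    ∃ g : Module.Dual ℝ V, ∀ x ∈ C, x ≠ 0 → 0 < g x := by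
  refine ⟨∑ l ∈ L, l, fun x hx hx0 => ?_⟩
  have hnn := (hL x).1 hx
  rw [LinearMap.sum_apply]
  refine (Finset.sum_nonneg hnn).lt_of_ne fun h => hC x hx hx0 ?_
  have hz := (Finset.sum_eq_zero_iff_of_nonneg hnn).1 h.symm
  exact (hL _).2 fun l hl => by rw [map_neg, hz l hl, neg_zero]

/-- If a neighborhood of `e` in `C` were contained in `Δ`, then `e` would be the midpoint of a short
segment in `Δ` on the ray through `e`. -/
theorem mem_closure_diff_of_mem_extremePoints (hΔC : Δ ⊆ C) (h0 : (0 : V) ∉ Δ) {e : V}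
    (he : e ∈ Δ.extremePoints ℝ) : e ∈ closure ((C : Set V) \ Δ) := by
  by_contra hcl
  have he0 : e ≠ 0 := fun h => h0 (h ▸ he.1)
  have hcont : Tendsto (fun t : ℝ => (1 + t) • e) (𝓝 0) (𝓝 e) :=
    Continuous.tendsto' (by fun_prop) _ _ (by simp)
  have hev := hcont (isClosed_closure.isOpen_compl.mem_nhds hcl)
  obtain ⟨ε, hε, hball⟩ := Metric.mem_nhds_iff.1 hev
  have hmem : ∀ t : ℝ, |t| < ε → |t| < 1 → (1 + t) • e ∈ Δ := fun t ht ht1 => by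
    have h1 : (1 + t) • e ∉ closure ((C : Set V) \ Δ) := hball (by simpa using ht)
    by_contra hn
    exact h1 (subset_closure ⟨C.smul_mem (by linarith [(abs_lt.1 ht1).1]) (hΔC he.1), hn⟩)
  set t := min (ε / 2) (1 / 2) with ht
  have ht0 : 0 < t := by positivity
  have h1 : |t| < ε := by rw [abs_of_pos ht0]; exact (min_le_left _ _).trans_lt (by linarith)
  have h2 : |t| < 1 := by rw [abs_of_pos ht0]; exact (min_le_right _ _).trans_lt (by norm_num)
  have h3 := he.2 (hmem t h1 h2) (hmem (-t) (by rwa [abs_neg]) (by rwa [abs_neg]))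
    ⟨1 / 2, 1 / 2, by norm_num, by norm_num, by norm_num, by module⟩
  rw [add_smul, one_smul, add_eq_left, smul_eq_zero] at h3
  exact h3.elim ht0.ne' he0

variable [FiniteDimensional ℝ V]

theorem isBounded_sublevel (hC : IsClosed (C : Set V)) {g : Module.Dual ℝ V}
    (hg : ∀ x ∈ C, x ≠ 0 → 0 < g x) (r : ℝ) :
    Bornology.IsBounded {x | x ∈ C ∧ g x ≤ r} := by
  have := FiniteDimensional.proper ℝ V
  have hgc : Continuous g := g.continuous_of_finiteDimensional
  have hK : IsCompact ((C : Set V) ∩ Metric.sphere 0 1) := (isCompact_sphere 0 1).inter_left hC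
  rcases ((C : Set V) ∩ Metric.sphere 0 1).eq_empty_or_nonempty with hemp | hne
  · refine (Set.finite_singleton (0 : V)).isBounded.subset fun x hx => ?_
    by_contra hx0
    have : ‖x‖⁻¹ • x ∈ (C : Set V) ∩ Metric.sphere 0 1 :=
      ⟨C.smul_mem (by positivity) hx.1, by simpa using norm_smul_inv_norm (𝕜 := ℝ) hx0⟩
    rwa [hemp] at this
  · obtain ⟨z, hz, hmin⟩ := hK.exists_isMinOn hne hgc.continuousOn
    have hz0 : z ≠ 0 := fun h => by simpa [h] using hz.2
    have hm := hg z hz.1 hz0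
    refine isBounded_iff_forall_norm_le.2 ⟨r / g z, fun x hx => ?_⟩
    rw [le_div_iff₀ hm]
    rcases eq_or_ne x 0 with rfl | hx0
    · simpa using hx.2
    have h1 : g z ≤ g (‖x‖⁻¹ • x) :=
      hmin ⟨C.smul_mem (by positivity) hx.1, by simpa using norm_smul_inv_norm (𝕜 := ℝ) hx0⟩
    rw [map_smul, smul_eq_mul, inv_mul_eq_div, le_div_iff₀ (norm_pos_iff.2 hx0), mul_comm] at h1
    exact h1.trans hx.2

/-- A functional that is positive on `C ∖ {0}` attains its minimum over `Δ` on a compact face, which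
has an extreme point. -/
theorem exists_mem_extremePoints_le (hC : IsClosed (C : Set V)) (hΔC : Δ ⊆ C)
    (hcl : IsClosed Δ) {g : Module.Dual ℝ V}
    (hg : ∀ x ∈ C, x ≠ 0 → 0 < g x) {x : V} (hx : x ∈ Δ) :
    ∃ e ∈ Δ.extremePoints ℝ, g e ≤ g x := by
  have := FiniteDimensional.proper ℝ V
  have hgc : Continuous g := g.continuous_of_finiteDimensional
  have hK : IsCompact (Δ ∩ {y | g y ≤ g x}) :=
    Metric.isCompact_of_isClosed_isBounded (hcl.inter (isClosed_le hgc continuous_const))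
      ((isBounded_sublevel hC hg (g x)).subset fun y hy => ⟨hΔC hy.1, hy.2⟩)
  obtain ⟨z, hz, hmin⟩ := hK.exists_isMinOn ⟨x, hx, le_refl (g x)⟩ hgc.continuousOn
  have hmin' : ∀ y ∈ Δ, g z ≤ g y := fun y hy => by
    rcases le_total (g y) (g x) with h | h
    · exact hmin ⟨hy, h⟩
    · exact le_trans hz.2 h
  let f : StrongDual ℝ V := -(LinearMap.toContinuousLinearMap g)
  have hf : ∀ y, f y = -g y := fun y => rfl
  set F : Set V := {y ∈ Δ | ∀ w ∈ Δ, f w ≤ f y} with hF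
  have hexp : IsExposed ℝ Δ F := fun _ => ⟨f, rfl⟩
  have hFle : ∀ y ∈ F, g y ≤ g z := fun y hy => by
    have := hy.2 z hz.1
    rw [hf, hf] at this
    linarith
  have hFK : F ⊆ Δ ∩ {y | g y ≤ g x} := fun y hy => ⟨hy.1, (hFle y hy).trans hz.2⟩
  have hFc : IsCompact F := hK.of_isClosed_subset (hexp.isClosed hcl) hFK
  have hFne : F.Nonempty := ⟨z, hz.1, fun w hw => by rw [hf, hf]; linarith [hmin' w hw]⟩
  obtain ⟨e, he⟩ := hFc.extremePoints_nonempty hFne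
  exact ⟨e, hexp.isExtreme.extremePoints_subset_extremePoints he, (hFK he.1).2⟩

/-- `Δ` is contained in `conv E + C`, where `E` is the set of its extreme points. Otherwise one of
the affine inequalities that define `conv E + C` fails at some `x ∈ Δ`; after a small perturbation, it
is minimized over `Δ` at an extreme point. -/
theorem exists_mem_convexHull_extremePoints (hC : IsClosed (C : Set V))
    (hsal : (C : ConvexCone ℝ V).Salient)
    {s : Finset V} (hs : C = PointedCone.hull ℝ (s : Set V)) (hΔC : Δ ⊆ C)
    (hcl : IsClosed Δ) {E : Finset V} (hE : (E : Set V) = Δ.extremePoints ℝ) {x : V} (hx : x ∈ Δ) :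
    ∃ y ∈ convexHull ℝ (E : Set V), x - y ∈ C := by
  obtain ⟨L₀, hL₀⟩ := exists_dual_hull s
  obtain ⟨f, hf⟩ := exists_dual_pos hsal (L := L₀) (fun x => by rw [hs, hL₀])
  have hf0 : ∀ x ∈ C, 0 ≤ f x := fun x hx => by
    rcases eq_or_ne x 0 with rfl | h
    · simp
    · exact (hf x hx h).le
  obtain ⟨L, hL⟩ := exists_dual_convexHull_add_hull E s
  rw [← hs] at hL
  rw [hL]
  by_contra! hcon
  obtain ⟨⟨g, c⟩, hl, hlt⟩ := hcon
  have hP : ∀ e ∈ E, ∀ u ∈ C, 0 ≤ g (e + u) + c := fun e he u hu =>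
    (hL _).1 ⟨e, subset_convexHull ℝ _ he, by simpa using hu⟩ _ hl
  obtain ⟨e₀, he₀, -⟩ := exists_mem_extremePoints_le hC hΔC hcl hf hx
  have hg0 : ∀ u ∈ C, 0 ≤ g u := fun u hu => by
    by_contra! hneg
    have h1 := hP e₀ (by rw [← Finset.mem_coe, hE]; exact he₀)
      (((g e₀ + c + 1) / -g u) • u) (C.smul_mem (div_nonneg ?_ (by linarith)) hu)
    · rw [map_add, map_smul, smul_eq_mul, div_neg, neg_mul, div_mul_cancel₀ _ hneg.ne] at h1
      linarith
    · have := hP e₀ (by rw [← Finset.mem_coe, hE]; exact he₀) 0 (zero_mem C)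
      rw [add_zero] at this
      linarith
  -- a small multiple of `f` makes `g` positive on `C \ {0}`, and does not spoil `g x + c < 0`
  have hfx := hf0 x (hΔC hx)
  dsimp only at hlt
  set ε := -(g x + c) / (f x + 1) with hε
  have hε0 : 0 < ε := div_pos (by linarith) (by linarith)
  have hεx : ε * f x < -(g x + c) := by
    rw [hε, div_mul_eq_mul_div, div_lt_iff₀ (by linarith)]
    nlinarith
  obtain ⟨e, he, hle⟩ := exists_mem_extremePoints_le hC hΔC hcl (g := g + ε • f)
    (fun u hu hu0 => add_pos_of_nonneg_of_pos (hg0 u hu) (mul_pos hε0 (hf u hu hu0))) hx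
  have h1 := hP e (by rw [← Finset.mem_coe, hE]; exact he) 0 (zero_mem C)
  have h2 := mul_nonneg hε0.le (hf0 e (hΔC he.1))
  simp only [LinearMap.add_apply, LinearMap.smul_apply, smul_eq_mul] at hle
  rw [add_zero] at h1
  linarith

end BoundedComplement

/-! ### Local structure at a vertex -/

section Local
variable {V : Type*} [NormedAddCommGroup V] [NormedSpace ℝ V]

/-- Near `a`, the set `X` is invariant under translations in the direction `v`. -/
def LocallyInvariant (X : Set V) (a v : V) : Prop :=
  ∃ U ∈ 𝓝 a, ∀ x ∈ U, ∀ t : ℝ, x + t • v ∈ U → (x ∈ X ↔ x + t • v ∈ X)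

theorem LocallyInvariant.diff {X Y : Set V} {a v : V} (hX : LocallyInvariant X a v)
    (hY : LocallyInvariant Y a v) : LocallyInvariant (X \ Y) a v := by
  obtain ⟨U, hU, h⟩ := hX
  obtain ⟨W, hW, h'⟩ := hY
  exact ⟨U ∩ W, inter_mem hU hW, fun x hx t ht =>
    and_congr (h x hx.1 t ht.1) (not_congr (h' x hx.2 t ht.2))⟩

theorem LocallyInvariant.congr {X Y : Set V} {a v : V} (hX : LocallyInvariant X a v)
    (h : ∀ᶠ x in 𝓝 a, x ∈ X ↔ x ∈ Y) : LocallyInvariant Y a v := by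
  obtain ⟨U, hU, h'⟩ := hX
  exact ⟨U ∩ {x | x ∈ X ↔ x ∈ Y}, inter_mem hU h, fun x hx t ht =>
    hx.2.symm.trans ((h' x hx.1 t ht.1).trans ht.2)⟩

theorem locallyInvariant_of_notMem {X : Set V} (hX : IsClosed X) {a : V} (ha : a ∉ X) (v : V) :
    LocallyInvariant X a v :=
  ⟨Xᶜ, hX.isOpen_compl.mem_nhds ha, fun _ hx _ ht => iff_of_false hx ht⟩

theorem LocallyInvariant.eventually_add_smul_mem_closure {X : Set V} {a v : V}
    (hX : LocallyInvariant X a v) (ha : a ∈ closure X) :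
    ∀ᶠ t : ℝ in 𝓝 0, a + t • v ∈ closure X := by
  obtain ⟨U, hU, h⟩ := hX
  have hcont : Tendsto (fun t : ℝ => a + t • v) (𝓝 0) (𝓝 a) :=
    Continuous.tendsto' (by fun_prop) _ _ (by simp)
  filter_upwards [hcont (eventually_mem_nhds_iff.2 hU)] with t ht
  have hsh : Tendsto (fun x : V => x + t • v) (𝓝 a) (𝓝 (a + t • v)) :=
    Continuous.tendsto (by fun_prop) _
  have hev : ∀ᶠ x in 𝓝 a, x ∈ U ∧ x + t • v ∈ U := inter_mem hU (hsh ht)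
  exact mem_closure_of_frequently_of_tendsto
    ((mem_closure_iff_frequently.1 ha).and_eventually hev |>.mono
      fun x hx => (h x hx.2.1 t hx.2.2).1 hx.1) hsh

/-- If `X` contains a segment with `a` in its interior, then the inequalities of `X` that are
equalities at `a` are constant along the segment. -/
theorem eq_zero_of_active {X : Set V} {L : Finset (Module.Dual ℝ V × ℝ)}
    (hL : ∀ x, x ∈ X ↔ ∀ l ∈ L, 0 ≤ l.1 x + l.2) {a v : V} {s t : ℝ} (hs : 0 < s) (ht : 0 < t)
    (h1 : a + s • v ∈ X) (h2 : a - t • v ∈ X) :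
    ∀ l ∈ L, l.1 a + l.2 = 0 → l.1 v = 0 := fun l hl h => by
  have h1 := (hL _).1 h1 l hl
  have h2 := (hL _).1 h2 l hl
  rw [map_add, map_smul, smul_eq_mul] at h1
  rw [map_sub, map_smul, smul_eq_mul] at h2
  exact le_antisymm (nonpos_of_mul_nonpos_right (by linarith) ht)
    (nonneg_of_mul_nonneg_right (by linarith) hs)

variable {C : PointedCone ℝ V} {Δ A : Set V}

/-- For a convex set `Δ = conv E + C`, the cone of the directions from `a ∈ Δ` into `Δ` is generated
by `E - a` and `C`. -/
theorem exists_pos_add_smul_mem_iff (hconv : Convex ℝ Δ) (hadd : ∀ x ∈ Δ, ∀ c ∈ C, x + c ∈ Δ)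
    {E : Set V} (hE : E ⊆ Δ) (hΔ : ∀ x ∈ Δ, ∃ y ∈ convexHull ℝ E, x - y ∈ C)
    {a : V} (ha : a ∈ Δ) (v : V) :
    (∃ t : ℝ, 0 < t ∧ a + t • v ∈ Δ) ↔ v ∈ PointedCone.hull ℝ ((· - a) '' E) ⊔ C := by
  constructor
  · rintro ⟨t, ht, h⟩
    obtain ⟨y, hy, hyC⟩ := hΔ _ h
    have hyE : y - a ∈ PointedCone.hull ℝ ((· - a) '' E) := by
      have hEK : ∀ e ∈ E, e - a ∈ PointedCone.hull ℝ ((· - a) '' E) := fun e he =>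
        PointedCone.subset_hull (Set.mem_image_of_mem _ he)
      generalize PointedCone.hull ℝ ((· - a) '' E) = K at hEK
      have hc : Convex ℝ {x | x - a ∈ K} := fun x hx z hz p q hp hq hpq => by
        have h1 := K.convex hx hz hp hq hpq
        have h2 : p • x + q • z - a = p • (x - a) + q • (z - a) := by
          rw [show p = 1 - q by linarith]
          module
        rwa [Set.mem_ofPred_eq, h2]
      exact convexHull_min hEK hc hy
    have hv : v = t⁻¹ • ((y - a) + (a + t • v - y)) := by
      rw [show (y - a) + (a + t • v - y) = t • v by abel, smul_smul, inv_mul_cancel₀ ht.ne',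
        one_smul]
    rw [hv]
    exact PointedCone.smul_mem _ (by positivity)
      (add_mem (Submodule.mem_sup_left hyE) (Submodule.mem_sup_right hyC))
  · intro hv
    obtain ⟨w, hw, c, hc, rfl⟩ := Submodule.mem_sup.1 hv
    have key : ∃ t : ℝ, 0 < t ∧ a + t • w ∈ Δ := by
      clear hv
      induction hw using Submodule.span_induction with
      | mem x hx =>
        obtain ⟨e, he, rfl⟩ := hx
        exact ⟨1, one_pos, by simpa using hE he⟩
      | zero => exact ⟨1, one_pos, by simpa using ha⟩
      | add x y _ _ hx hy =>
        obtain ⟨s, hs, hx⟩ := hx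
        obtain ⟨t, ht, hy⟩ := hy
        refine ⟨s * t / (s + t), by positivity, ?_⟩
        convert hconv hx hy (a := t / (s + t)) (b := s / (s + t)) (by positivity) (by positivity)
          (by rw [← add_div, add_comm, div_self (by positivity)]) using 1
        match_scalars <;> field_simp
        ring
      | smul r x _ hx =>
        obtain ⟨t, ht, hx⟩ := hx
        rcases eq_or_lt_of_le r.2 with h | h
        · refine ⟨1, one_pos, ?_⟩
          have : r = 0 := Subtype.ext h.symm
          simpa [this] using ha
        · refine ⟨t / r.1, div_pos ht h, ?_⟩
          rw [show (t / r.1) • (r • x) = (t / r.1) • (r.1 • x) from rfl, smul_smul,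
            div_mul_cancel₀ _ h.ne']
          exact hx
    obtain ⟨t, ht, h⟩ := key
    refine ⟨t, ht, ?_⟩
    rw [smul_add, ← add_assoc]
    exact hadd _ h _ (C.smul_mem ht.le hc)

variable [FiniteDimensional ℝ V]

theorem locallyInvariant_of_forall_active {X : Set V} {L : Finset (Module.Dual ℝ V × ℝ)}
    (hL : ∀ x, x ∈ X ↔ ∀ l ∈ L, 0 ≤ l.1 x + l.2) {a v : V} (ha : a ∈ X)
    (hv : ∀ l ∈ L, l.1 a + l.2 = 0 → l.1 v = 0) : LocallyInvariant X a v := by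
  refine ⟨{x | ∀ l ∈ L, 0 < l.1 a + l.2 → 0 < l.1 x + l.2}, ?_, fun x hx t ht => ?_⟩
  · refine (Filter.eventually_all_finset L).2 fun l _ => ?_
    have hc : Continuous fun x => l.1 x + l.2 :=
      l.1.continuous_of_finiteDimensional.add continuous_const
    by_cases h : 0 < l.1 a + l.2
    · filter_upwards [hc.continuousAt.eventually (lt_mem_nhds h)] with x hx _ using hx
    · exact Eventually.of_forall fun x hx => absurd hx h
  · rw [hL, hL]
    refine forall₂_congr fun l hl => ?_
    rcases ((hL a).1 ha l hl).eq_or_lt with h | h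
    · rw [map_add, map_smul, hv l hl h.symm, smul_zero, add_zero]
    · exact iff_of_true (hx l hl h).le (ht l hl h).le

/-- Away from the origin, the points of the closure of `A = C ∖ (Δ ∪ {0})` at which `A` is not
translation invariant in any direction are the extreme points of `Δ`. -/
theorem mem_extremePoints_iff_forall_not_locallyInvariant {L L' : Finset (Module.Dual ℝ V × ℝ)}
    (hL : ∀ x, x ∈ C ↔ ∀ l ∈ L, 0 ≤ l.1 x + l.2)
    (hL0 : ∀ l ∈ L, l.2 = 0) (hC : IsClosed (C : Set V))
    (hL' : ∀ x, x ∈ Δ ↔ ∀ l ∈ L', 0 ≤ l.1 x + l.2)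
    (hΔC : Δ ⊆ C) (hcl : IsClosed Δ) (h0 : (0 : V) ∉ Δ) (hA : A = (C : Set V) \ (Δ ∪ {0})) {a : V} :
    a ∈ Δ.extremePoints ℝ ↔
      a ≠ 0 ∧ a ∈ closure A ∧ ∀ v : V, v ≠ 0 → ¬ LocallyInvariant A a v := by
  have hnear : a ≠ 0 → ∀ᶠ x in 𝓝 a, x ∈ (C : Set V) \ Δ ↔ x ∈ A := fun ha => by
    filter_upwards [isOpen_ne.mem_nhds ha] with x hx
    simp only [hA, Set.mem_sdiff, Set.mem_union, Set.mem_singleton_iff, show x ≠ 0 from hx,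
      or_false]
  have hAC : A ⊆ C := hA ▸ Set.sdiff_subset
  constructor
  · intro ha
    have ha0 : a ≠ 0 := fun h => h0 (h ▸ ha.1)
    have hacl : a ∈ closure A := by
      have := mem_closure_diff_of_mem_extremePoints hΔC h0 ha
      rw [mem_closure_iff_frequently] at this ⊢
      exact (this.and_eventually (hnear ha0)).mono fun x hx => hx.2.1 hx.1
    refine ⟨ha0, hacl, fun v hv hinv => ?_⟩
    have hev := hinv.eventually_add_smul_mem_closure hacl
    have hevC : ∀ᶠ t : ℝ in 𝓝 0, a + t • v ∈ C := hev.mono fun t ht =>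
      closure_minimal hAC hC ht
    -- the directions of local invariance of `A` at `a` are in the lineality space of `C` at `a`
    have hCinv : LocallyInvariant (C : Set V) a v := by
      obtain ⟨t, ht, h1, h2⟩ : ∃ t : ℝ, 0 < t ∧ a + t • v ∈ C ∧ a + (-t) • v ∈ C := by
        have hneg : Tendsto (fun t : ℝ => -t) (𝓝[>] 0) (𝓝 0) :=
          (Continuous.tendsto' (by fun_prop) _ _ (by simp)).mono_left nhdsWithin_le_nhds
        have := (hevC.filter_mono (nhdsWithin_le_nhds (s := Set.Ioi 0))).and (hneg hevC)
        obtain ⟨t, h, ht⟩ := (this.and self_mem_nhdsWithin).exists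
        exact ⟨t, ht, h.1, h.2⟩
      rw [neg_smul, ← sub_eq_add_neg] at h2
      exact locallyInvariant_of_forall_active hL (hΔC ha.1)
        (eq_zero_of_active (X := (C : Set V)) hL ht ht h1 h2)
    have hΔinv : LocallyInvariant Δ a v := by
      refine (hCinv.diff hinv).congr ?_
      filter_upwards [hnear ha0] with x hx
      rw [Set.mem_sdiff, ← hx]
      exact ⟨fun h => by_contra fun h' => h.2 ⟨h.1, h'⟩, fun h => ⟨hΔC h, fun h' => h'.2 h⟩⟩
    obtain ⟨U, hU, hUinv⟩ := hΔinv
    have hcont : Tendsto (fun t : ℝ => a + t • v) (𝓝 0) (𝓝 a) :=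
      Continuous.tendsto' (by fun_prop) _ _ (by simp)
    have hcont' : Tendsto (fun t : ℝ => a + (-t) • v) (𝓝 0) (𝓝 a) :=
      Continuous.tendsto' (by fun_prop) _ _ (by simp)
    have hb : ∀ᶠ t : ℝ in 𝓝[>] 0, a + t • v ∈ U ∧ a + (-t) • v ∈ U :=
      nhdsWithin_le_nhds (inter_mem (hcont hU) (hcont' hU))
    obtain ⟨t, ⟨h1, h2⟩, ht⟩ := (hb.and self_mem_nhdsWithin).exists
    have haU := mem_of_mem_nhds hU
    have := ha.2 ((hUinv a haU t h1).1 ha.1) ((hUinv a haU (-t) h2).1 ha.1)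
      ⟨1 / 2, 1 / 2, by norm_num, by norm_num, by norm_num, by module⟩
    rw [add_eq_left, smul_eq_zero] at this
    exact this.elim (ne_of_gt ht) hv
  · rintro ⟨ha0, hacl, hinv⟩
    by_contra hext
    have haC : a ∈ C := closure_minimal hAC hC hacl
    by_cases haΔ : a ∈ Δ
    · have : ∃ x₁ ∈ Δ, ∃ x₂ ∈ Δ, a ∈ openSegment ℝ x₁ x₂ ∧ x₁ ≠ a := by
        by_contra! hcon
        exact hext ⟨haΔ, fun x₁ h₁ x₂ h₂ h => hcon x₁ h₁ x₂ h₂ h⟩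
      obtain ⟨x₁, h₁, x₂, h₂, ⟨p, q, hp, hq, hpq, hseg⟩, hne⟩ := this
      have e1 : a + (1 : ℝ) • (x₁ - a) = x₁ := by module
      have e2 : a - (p / q) • (x₁ - a) = x₂ := by
        have hp' : p = 1 - q := by linarith
        have : q • x₂ = a - p • x₁ := by rw [← hseg]; module
        have h3 : x₂ = q⁻¹ • (a - p • x₁) := by
          rw [← this, smul_smul, inv_mul_cancel₀ hq.ne', one_smul]
        rw [h3, hp']
        match_scalars <;> field_simp
        ring
      refine hinv (x₁ - a) (sub_ne_zero.2 hne) (LocallyInvariant.congr (.diff ?_ ?_) (hnear ha0))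
      · exact locallyInvariant_of_forall_active hL haC <|
          eq_zero_of_active (X := (C : Set V)) hL one_pos (div_pos hp hq)
            (e1.symm ▸ hΔC h₁) (e2.symm ▸ hΔC h₂)
      · exact locallyInvariant_of_forall_active hL' haΔ <|
          eq_zero_of_active hL' one_pos (div_pos hp hq) (e1.symm ▸ h₁) (e2.symm ▸ h₂)
    · refine hinv a ha0 (LocallyInvariant.congr (.diff ?_ ?_) (hnear ha0))
      · exact locallyInvariant_of_forall_active hL haC
          fun l hl h => by rwa [hL0 l hl, add_zero] at h
      · exact locallyInvariant_of_notMem hcl haΔ a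

end Local

section Tangent
variable {d : ℕ} {C : PointedCone ℝ (Fin d → ℝ)} {Δ : Set (Fin d → ℝ)}

theorem tangentCone_insert_zero_eq (hconv : Convex ℝ Δ) {a : Fin d → ℝ} (ha : a ∈ Δ) (h0 : 0 ∉ Δ) :
    tangentCone (insert 0 Δ) a = {v | ∃ t : ℝ, 0 < t ∧ a + t • v ∈ Δ} := by
  have ha0 : a ≠ 0 := fun h => h0 (h ▸ ha)
  have hne : ∀ v : Fin d → ℝ, ∀ᶠ t : ℝ in 𝓝[>] 0, a + t • v ≠ 0 := fun v => by
    have hcont : Tendsto (fun t : ℝ => a + t • v) (𝓝 0) (𝓝 a) :=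
      Continuous.tendsto' (by fun_prop) _ _ (by simp)
    exact (hcont.eventually_ne ha0).filter_mono nhdsWithin_le_nhds
  ext v
  constructor
  · intro hv
    have hv' : ∀ᶠ t : ℝ in 𝓝[>] 0, a + t • v ∈ insert 0 Δ := hv
    obtain ⟨t, ⟨h1, h2⟩, ht⟩ := ((hv'.and (hne v)).and self_mem_nhdsWithin).exists
    exact ⟨t, ht, h1.resolve_left h2⟩
  · rintro ⟨t, ht, h⟩
    filter_upwards [Ioo_mem_nhdsGT ht] with s hs
    refine Or.inr ?_
    convert hconv ha h (a := 1 - s / t) (b := s / t)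
      (sub_nonneg.2 ((div_le_one ht).2 hs.2.le)) (div_nonneg hs.1.le ht.le) (by ring) using 1
    match_scalars <;> field_simp
    ring

theorem eventually_mem_tangentCone_iff {L : Finset (Module.Dual ℝ (Fin d → ℝ) × ℝ)}
    (hL : ∀ x, x ∈ Δ ↔ ∀ l ∈ L, 0 ≤ l.1 x + l.2) (hconv : Convex ℝ Δ) {a : Fin d → ℝ}
    (ha : a ∈ Δ) (h0 : 0 ∉ Δ) :
    ∀ᶠ v in 𝓝 0, v ∈ tangentCone (insert 0 Δ) a ↔ a + v ∈ insert 0 Δ := by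
  have ha0 : a ≠ 0 := fun h => h0 (h ▸ ha)
  rw [tangentCone_insert_zero_eq hconv ha h0]
  have hcont : Tendsto (fun v => a + v) (𝓝 0) (𝓝 a) :=
    Continuous.tendsto' (by fun_prop) _ _ (by simp)
  have hL1 : ∀ᶠ v in 𝓝 (0 : Fin d → ℝ), ∀ l ∈ L, 0 < l.1 a + l.2 → 0 < l.1 (a + v) + l.2 := by
    refine (Filter.eventually_all_finset L).2 fun l _ => ?_
    have hc : Continuous fun x => l.1 x + l.2 :=
      l.1.continuous_of_finiteDimensional.add continuous_const
    by_cases h : 0 < l.1 a + l.2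
    · filter_upwards [hcont (hc.continuousAt.eventually (lt_mem_nhds h))] with x hx _ using hx
    · exact Eventually.of_forall fun x hx => absurd hx h
  filter_upwards [hL1, hcont.eventually_ne ha0] with v hv hne
  constructor
  · rintro ⟨t, ht, h⟩
    refine Or.inr ((hL _).2 fun l hl => ?_)
    rcases ((hL a).1 ha l hl).eq_or_lt with h' | h'
    · have := (hL _).1 h l hl
      rw [map_add, map_smul, smul_eq_mul] at this
      rw [map_add]
      nlinarith [nonneg_of_mul_nonneg_right (show 0 ≤ t * l.1 v by linarith) ht]
    · exact (hv l hl h').le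
  · intro h
    exact ⟨1, one_pos, by simpa using h.resolve_left hne⟩

end Tangent

/-! ### Summation of series and rationality for integer cones -/

section Series
variable {d : ℕ}

theorem intVec_add (a b : Fin d → ℤ) : intVec (a + b) = intVec a + intVec b := by
  ext; simp [intVec]

theorem intVec_sub (a b : Fin d → ℤ) : intVec (a - b) = intVec a - intVec b := by
  ext; simp [intVec]

theorem intVec_zero : intVec (0 : Fin d → ℤ) = 0 := by
  ext; simp [intVec]

theorem intVec_injective : Function.Injective (intVec (d := d)) := fun a b h => by
  ext i
  exact Int.cast_injective (congrFun h i)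

theorem finite_preimage_intVec {X : Set (Fin d → ℝ)} (hX : Bornology.IsBounded X) :
    (intVec ⁻¹' X).Finite := by
  obtain ⟨R, hR⟩ := hX.exists_norm_le
  refine (Set.finite_Icc (fun _ : Fin d => -⌈R⌉) (fun _ => ⌈R⌉)).subset fun n hn => ?_
  have key : ∀ i, |(n i : ℝ)| ≤ ⌈R⌉ := fun i =>
    ((norm_le_pi_norm (intVec n) i).trans (hR _ hn)).trans (Int.le_ceil R)
  exact ⟨fun i => by exact_mod_cast (abs_le.1 (key i)).1,
    fun i => by exact_mod_cast (abs_le.1 (key i)).2⟩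

theorem mulSeries_smul (q : Laurent d) (f : (Fin d → ℤ) → ℚ) (c : ℚ) :
    mulSeries q (c • f) = c • mulSeries q f := by
  funext n
  simp only [mulSeries, Pi.smul_apply, smul_eq_mul, Finsupp.mul_sum]
  exact Finsupp.sum_congr fun m _ => by ring

theorem mulSeries_neg (q : Laurent d) (f : (Fin d → ℤ) → ℚ) :
    mulSeries q (-f) = -mulSeries q f := by
  simpa using mulSeries_smul q f (-1)

theorem mulSeries_zero_right (q : Laurent d) : mulSeries q 0 = 0 := by
  simpa using mulSeries_smul q 0 0

theorem one_sub_single_ne_zero {u : Fin d → ℤ} (hu : u ≠ 0) :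
    (1 - AddMonoidAlgebra.single u 1 : Laurent d) ≠ 0 := by
  intro h
  have h1 := congrArg (fun p : Laurent d => p.coeff 0) h
  simp [AddMonoidAlgebra.one_def, hu] at h1

theorem mulSeries_one_sub_single (u : Fin d → ℤ) (f : (Fin d → ℤ) → ℚ) (n : Fin d → ℤ) :
    mulSeries (1 - AddMonoidAlgebra.single u 1) f n = f n - f (n - u) := by
  have h := congrFun (mulSeries_add (1 - AddMonoidAlgebra.single u 1)
    (AddMonoidAlgebra.single u 1) f) n
  rw [sub_add_cancel, AddMonoidAlgebra.one_def, Pi.add_apply, mulSeries_single,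
    mulSeries_single] at h
  rw [AddMonoidAlgebra.one_def]
  simp only [one_mul, sub_zero] at h
  linarith

variable (d) in
/-- The series that are annihilated by some nonzero Laurent polynomial. These are the series that
sum to the rational function `0`. -/
def torsionSeries : AddSubgroup ((Fin d → ℤ) → ℚ) where
  carrier := {f | ∃ q : Laurent d, q ≠ 0 ∧ mulSeries q f = 0}
  zero_mem' := ⟨1, one_ne_zero, mulSeries_zero_right 1⟩
  add_mem' := by
    rintro f g ⟨p, hp, hpf⟩ ⟨q, hq, hqg⟩
    refine ⟨p * q, mul_ne_zero hp hq, ?_⟩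
    rw [mulSeries_add_right, mulSeries_mul p q g, hqg, mul_comm, mulSeries_mul q p f, hpf,
      mulSeries_zero_right, mulSeries_zero_right, add_zero]
  neg_mem' := by
    rintro f ⟨q, hq, hqf⟩
    exact ⟨q, hq, by rw [mulSeries_neg, hqf, neg_zero]⟩

/-- The series `f` sums to the rational function `r`. For the series of the integer points of `X`,
this is `HasGenFun X r` by definition. -/
def SumsTo (f : (Fin d → ℤ) → ℚ) (r : RatFun d) : Prop :=
  ∃ p q : Laurent d, q ≠ 0 ∧ mulSeries q f = p.coeff ∧
    r = algebraMap (Laurent d) (RatFun d) p / algebraMap (Laurent d) (RatFun d) q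

theorem algebraMap_ratFun_ne_zero {q : Laurent d} (hq : q ≠ 0) :
    algebraMap (Laurent d) (RatFun d) q ≠ 0 :=
  (map_ne_zero_iff _ (IsFractionRing.injective (Laurent d) (RatFun d))).2 hq

theorem SumsTo.add {f g : (Fin d → ℤ) → ℚ} {r s : RatFun d} (hf : SumsTo f r) (hg : SumsTo g s) :
    SumsTo (f + g) (r + s) := by
  obtain ⟨p, q, hq, h, rfl⟩ := hf
  obtain ⟨p', q', hq', h', rfl⟩ := hg
  refine ⟨p * q' + q * p', q * q', mul_ne_zero hq hq', ?_, ?_⟩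
  · rw [mulSeries_add_right, mulSeries_mul q q' g, h', mulSeries_coeff, mul_comm q,
      mulSeries_mul q' q f, h, mulSeries_coeff, mul_comm q' p, AddMonoidAlgebra.coeff_add, Finsupp.coe_add]
  · rw [div_add_div _ _ (algebraMap_ratFun_ne_zero hq) (algebraMap_ratFun_ne_zero hq')]
    simp only [map_add, map_mul]

theorem SumsTo.neg {f : (Fin d → ℤ) → ℚ} {r : RatFun d} (hf : SumsTo f r) :
    SumsTo (-f) (-r) := by
  obtain ⟨p, q, hq, h, rfl⟩ := hf
  exact ⟨-p, q, hq, by rw [mulSeries_neg, h]; rfl, by rw [map_neg, neg_div]⟩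

theorem SumsTo.sub {f g : (Fin d → ℤ) → ℚ} {r s : RatFun d} (hf : SumsTo f r) (hg : SumsTo g s) :
    SumsTo (f - g) (r - s) := by
  rw [sub_eq_add_neg, sub_eq_add_neg]
  exact hf.add hg.neg

theorem SumsTo.shift {f : (Fin d → ℤ) → ℚ} {r : RatFun d} (hf : SumsTo f r) (a : Fin d → ℤ) :
    SumsTo (fun n => f (n - a)) (mono a * r) := by
  obtain ⟨p, q, hq, h, rfl⟩ := hf
  have hs : (fun n => f (n - a)) = mulSeries (AddMonoidAlgebra.single a 1) f := by
    funext n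
    rw [mulSeries_single, one_mul]
  refine ⟨AddMonoidAlgebra.single a 1 * p, q, hq, ?_, ?_⟩
  · rw [hs, ← mulSeries_mul, mul_comm, mulSeries_mul, h, mulSeries_coeff]
  · rw [mono, ← mul_div_assoc, map_mul]

theorem SumsTo.of_sub_mem {f g : (Fin d → ℤ) → ℚ} {r : RatFun d} (hg : SumsTo g r)
    (h : f - g ∈ torsionSeries d) : SumsTo f r := by
  obtain ⟨q, hq, hqf⟩ := h
  have h0 : SumsTo (f - g) 0 := ⟨0, q, hq, by rw [hqf]; rfl, by simp⟩
  simpa using h0.add hg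

theorem SumsTo.sum {ι : Type*} (s : Finset ι) {f : ι → (Fin d → ℤ) → ℚ} {r : ι → RatFun d}
    (h : ∀ i ∈ s, SumsTo (f i) (r i)) : SumsTo (∑ i ∈ s, f i) (∑ i ∈ s, r i) := by
  classical
  induction s using Finset.induction_on with
  | empty => exact ⟨0, 1, one_ne_zero, by simp [mulSeries_zero_right], by simp⟩
  | insert a s ha ih =>
    rw [Finset.sum_insert ha, Finset.sum_insert ha]
    exact (h a (Finset.mem_insert_self _ _)).add (ih fun i hi => h i (Finset.mem_insert_of_mem hi))

theorem sumsTo_singleton_zero : SumsTo (indicatorSeries ({0} : Set (Fin d → ℝ))) 1 := by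
  classical
  refine ⟨1, 1, one_ne_zero, ?_, by simp⟩
  funext n
  rw [AddMonoidAlgebra.one_def, mulSeries_single]
  simp only [indicatorSeries, sub_zero, one_mul, Set.indicator_apply, Set.mem_preimage,
    Set.mem_singleton_iff, ← intVec_zero (d := d), intVec_injective.eq_iff,
    AddMonoidAlgebra.coeff_single, Finsupp.single_apply, eq_comm (a := n), Pi.one_apply]

theorem mulSeries_eq_zero_of_forall {q : Laurent d} {f : (Fin d → ℤ) → ℚ} {n : Fin d → ℤ}
    (h : ∀ m ∈ q.coeff.support, f (n - m) = 0) : mulSeries q f n = 0 :=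
  Finset.sum_eq_zero fun m hm => mul_eq_zero_of_right _ (h m hm)

/-- If `K` is the cone generated by `s`, then multiplication by `∏ (1 - x^u)`, `u ∈ s`, turns the
series of `K` into a Laurent polynomial. For an exponent `n = m + ∑ c_k k` to survive in the
product, it has to lie, for every `u ∈ s`, within a bounded distance of a facet of `K` that does not
contain `u`; this bounds `c_u`. -/
theorem exists_hasGenFun_hull (s : Finset (Fin d → ℤ)) :
    ∃ r, HasGenFun (PointedCone.hull ℝ (intVec '' (s : Set (Fin d → ℤ))) : Set (Fin d → ℝ)) r := by
  classical
  wlog hs : (0 : Fin d → ℤ) ∉ s generalizing s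
  · have := this (s.erase 0) (Finset.notMem_erase _ _)
    rwa [Finset.coe_erase, Set.image_sdiff intVec_injective, Set.image_singleton, intVec_zero,
      PointedCone.hull, Submodule.span_sdiff_singleton_zero] at this
  set K := PointedCone.hull ℝ (intVec '' (s : Set (Fin d → ℤ))) with hK
  have hsK : ∀ u ∈ s, intVec u ∈ K := fun u hu => PointedCone.subset_hull ⟨u, hu, rfl⟩
  obtain ⟨L, hL⟩ := exists_dual_hull (s.image intVec)
  rw [Finset.coe_image, ← hK] at hL
  let φ : (Fin d → ℤ) → Laurent d := fun u => 1 - AddMonoidAlgebra.single u 1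
  have hφ : ∀ u ∈ s, φ u ≠ 0 := fun u hu => one_sub_single_ne_zero fun h => hs (h ▸ hu)
  set f := indicatorSeries (K : Set (Fin d → ℝ)) with hf
  have hfK : ∀ n, f n ≠ 0 → intVec n ∈ K := fun n hn => by
    by_contra h
    exact hn (Set.indicator_of_notMem (s := intVec ⁻¹' (K : Set (Fin d → ℝ))) h _)
  have hfK' : ∀ n, intVec n ∈ K → f n = 1 := fun n hn =>
    Set.indicator_of_mem (s := intVec ⁻¹' (K : Set (Fin d → ℝ))) hn _
  set q : Laurent d := ∏ u ∈ s, φ u with hq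
  set M : Finset (Fin d → ℤ) := q.coeff.support ∪
    s.biUnion (fun u => (∏ k ∈ s.erase u, φ k).coeff.support) with hM
  obtain ⟨T, hT⟩ : ∃ T : ℝ, ∀ u ∈ s, ∀ l ∈ L, ∀ m ∈ M, ∀ m' ∈ M,
      1 + |l (intVec m - intVec m')| / l (intVec u) ≤ T := by
    obtain ⟨T, hT⟩ := ((s ×ˢ L ×ˢ M ×ˢ M).image fun p =>
      1 + |p.2.1 (intVec p.2.2.1 - intVec p.2.2.2)| / p.2.1 (intVec p.1)).bddAbove
    refine ⟨T, fun u hu l hl m hm m' hm' => hT ?_⟩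
    exact Finset.mem_coe.2 (Finset.mem_image.2 ⟨(u, l, m, m'), by simp [hu, hl, hm, hm'], rfl⟩)
  have hfin : (Function.support (mulSeries q f)).Finite := by
    obtain ⟨R, hR⟩ := (M.image fun m => ‖intVec m‖).bddAbove
    refine (finite_preimage_intVec (X := Metric.closedBall 0 (R + ∑ k ∈ s, T * ‖intVec k‖))
      Metric.isBounded_closedBall).subset fun n hn => ?_
    obtain ⟨m₀, hm₀, hnm₀⟩ : ∃ m ∈ q.coeff.support, f (n - m) ≠ 0 := by
      by_contra! hcon
      exact hn (mulSeries_eq_zero_of_forall hcon)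
    have hm₀M : m₀ ∈ M := Finset.mem_union_left _ hm₀
    obtain ⟨c, hc0, hc⟩ := mem_hull_image_finset.1 (hfK _ hnm₀)
    have hcT : ∀ u ∈ s, c u ≤ T := fun u hu => by
      obtain ⟨m, hm, hne⟩ : ∃ m ∈ (∏ k ∈ s.erase u, φ k).coeff.support,
          f (n - m) - f (n - m - u) ≠ 0 := by
        by_contra! hcon
        refine hn ?_
        rw [hq, ← Finset.prod_erase_mul s φ hu, mulSeries_mul]
        exact mulSeries_eq_zero_of_forall fun m hm =>
          (mulSeries_one_sub_single u f _).trans (hcon m hm)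
      have hmM : m ∈ M := Finset.mem_union_right _ (Finset.mem_biUnion.2 ⟨u, hu, hm⟩)
      have hnu : intVec (n - m - u) ∉ K := fun h => by
        have h' : intVec (n - m) ∈ K := by
          simpa [← intVec_add] using add_mem h (hsK u hu)
        rw [hfK' _ h, hfK' _ h', sub_self] at hne
        exact hne rfl
      have hnm : intVec (n - m) ∈ K := by
        by_contra h
        have h1 : f (n - m) = 0 := by_contra fun h' => h (hfK _ h')
        have h2 : f (n - m - u) = 0 := by_contra fun h' => hnu (hfK _ h')
        rw [h1, h2, sub_zero] at hne
        exact hne rfl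
      rw [hL] at hnu
      push Not at hnu
      obtain ⟨l, hl, hlneg⟩ := hnu
      have h0 := (hL _).1 hnm l hl
      rw [intVec_sub, map_sub] at hlneg
      have hlu : 0 < l (intVec u) := by linarith
      have hsum : c u * l (intVec u) ≤ l (intVec (n - m₀)) := by
        rw [← hc, map_sum]
        simp only [map_smul, smul_eq_mul]
        exact Finset.single_le_sum (f := fun i => c i * l (intVec i))
          (fun i hi => mul_nonneg (hc0 i hi) ((hL _).1 (hsK i hi) l hl)) hu
      have hshift : l (intVec (n - m₀)) = l (intVec (n - m)) + l (intVec m - intVec m₀) := by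
        rw [← map_add, intVec_sub, intVec_sub]
        congr 1
        abel
      refine le_trans ?_ (hT u hu l hl m hmM m₀ hm₀M)
      rw [← sub_le_iff_le_add', le_div_iff₀ hlu, sub_mul, one_mul]
      linarith [le_abs_self (l (intVec m - intVec m₀))]
    have hn' : intVec n = intVec m₀ + ∑ k ∈ s, c k • intVec k := by
      rw [hc, ← intVec_add, add_sub_cancel]
    rw [Set.mem_preimage, mem_closedBall_zero_iff, hn']
    refine (norm_add_le _ _).trans (add_le_add ?_ ?_)
    · exact hR (Finset.mem_coe.2 (Finset.mem_image_of_mem _ hm₀M))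
    · refine (norm_sum_le _ _).trans (Finset.sum_le_sum fun k hk => ?_)
      rw [norm_smul, Real.norm_of_nonneg (hc0 k hk)]
      exact mul_le_mul_of_nonneg_right (hcT k hk) (norm_nonneg _)
  refine ⟨_, AddMonoidAlgebra.ofCoeff (Finsupp.ofSupportFinite _ hfin), q,
    Finset.prod_ne_zero_iff.2 hφ, rfl, rfl⟩

end Series

/-! ### Brion's theorem modulo torsion -/

section Brion
variable {d : ℕ}

/-- The Minkowski sum `B + Q` of a set and a cone. -/
def addCone (B : Set (Fin d → ℝ)) (Q : PointedCone ℝ (Fin d → ℝ)) : Set (Fin d → ℝ) :=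
  {x | ∃ y ∈ B, x - y ∈ Q}

theorem convex_addCone {B : Set (Fin d → ℝ)} (hB : Convex ℝ B) (Q : PointedCone ℝ (Fin d → ℝ)) :
    Convex ℝ (addCone B Q) := by
  rintro x ⟨y, hy, hxy⟩ x' ⟨y', hy', hxy'⟩ p q hp hq hpq
  refine ⟨p • y + q • y', hB hy hy' hp hq hpq, ?_⟩
  have := Q.convex hxy hxy' hp hq hpq
  rwa [show p • x + q • x' - (p • y + q • y') = p • (x - y) + q • (x' - y') by module]

theorem mem_addCone_sup_ray {B : Set (Fin d → ℝ)} {Q : PointedCone ℝ (Fin d → ℝ)}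
    {u x : Fin d → ℝ} :
    x ∈ addCone B (Q ⊔ PointedCone.hull ℝ {u}) ↔ ∃ t : ℝ, 0 ≤ t ∧ x - t • u ∈ addCone B Q := by
  constructor
  · rintro ⟨y, hy, h⟩
    obtain ⟨a, ha, b, hb, hab⟩ := Submodule.mem_sup.1 h
    obtain ⟨t, rfl⟩ := Submodule.mem_span_singleton.1 hb
    refine ⟨t.1, t.2, y, hy, ?_⟩
    have : x - t.1 • u - y = a := by
      rw [sub_right_comm, ← hab]
      exact add_sub_cancel_right _ _
    rwa [this]
  · rintro ⟨t, ht, y, hy, h⟩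
    refine ⟨y, hy, Submodule.mem_sup.2 ⟨_, h, t • u, ?_, by abel⟩⟩
    exact Submodule.mem_span_singleton.2 ⟨⟨t, ht⟩, rfl⟩

theorem indicatorSeries_mem_torsionSeries {X : Set (Fin d → ℝ)} {u : Fin d → ℤ} (hu : u ≠ 0)
    (hX : ∀ x, x - intVec u ∈ X ↔ x ∈ X) : indicatorSeries X ∈ torsionSeries d := by
  classical
  refine ⟨1 - AddMonoidAlgebra.single u 1, one_sub_single_ne_zero hu, ?_⟩
  funext n
  rw [mulSeries_one_sub_single]
  simp only [indicatorSeries, Set.indicator_apply, Set.mem_preimage, intVec_sub, hX, sub_self,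
    Pi.zero_apply, Pi.one_apply]

theorem indicatorSeries_addCone_mem_torsionSeries (B : Set (Fin d → ℝ))
    {Q : PointedCone ℝ (Fin d → ℝ)} {u : Fin d → ℤ} (hu : u ≠ 0) (h : intVec u ∈ Q)
    (h' : -intVec u ∈ Q) : indicatorSeries (addCone B Q) ∈ torsionSeries d := by
  refine indicatorSeries_mem_torsionSeries hu fun x => exists_congr fun y => and_congr_right' ?_
  constructor
  · intro hx
    simpa [sub_right_comm] using add_mem hx h
  · intro hx
    simpa [sub_right_comm, ← sub_eq_add_neg] using add_mem hx h'

/-- For a convex set `P` and a direction `u`, the sets `P + ℝ≥0 u` and `P - ℝ≥0 u` meet in `P`, and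
their union `P + ℝ u` is invariant under translations by `u`. Hence, up to torsion, the series of
`P` is the sum of the series of these two sets. -/
theorem indicatorSeries_addCone_split {B : Set (Fin d → ℝ)} (hB : Convex ℝ B)
    (Q : PointedCone ℝ (Fin d → ℝ)) {u : Fin d → ℤ} (hu : u ≠ 0) :
    indicatorSeries (addCone B Q) - indicatorSeries (addCone B (Q ⊔ PointedCone.hull ℝ {intVec u}))
      - indicatorSeries (addCone B (Q ⊔ PointedCone.hull ℝ {-intVec u})) ∈ torsionSeries d := by
  classical
  set P := addCone B Q with hP
  have hPc : Convex ℝ P := convex_addCone hB Q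
  set X : Set (Fin d → ℝ) := {x | ∃ t : ℝ, x - t • intVec u ∈ P} with hX
  have hXt : indicatorSeries X ∈ torsionSeries d := by
    refine indicatorSeries_mem_torsionSeries hu fun x => ⟨?_, ?_⟩
    · rintro ⟨t, ht⟩
      exact ⟨1 + t, by rwa [add_smul, one_smul, ← sub_sub]⟩
    · rintro ⟨t, ht⟩
      exact ⟨t - 1, by rwa [sub_smul, one_smul, sub_sub, add_sub_cancel]⟩
  have key : indicatorSeries P
      - indicatorSeries (addCone B (Q ⊔ PointedCone.hull ℝ {intVec u}))
      - indicatorSeries (addCone B (Q ⊔ PointedCone.hull ℝ {-intVec u})) = -indicatorSeries X := by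
    funext n
    have h1 := mem_addCone_sup_ray (B := B) (Q := Q) (u := intVec u) (x := intVec n)
    have h2 := mem_addCone_sup_ray (B := B) (Q := Q) (u := -intVec u) (x := intVec n)
    simp only [smul_neg, sub_neg_eq_add, ← hP] at h1 h2
    have hint : intVec n ∈ P ↔ intVec n ∈ addCone B (Q ⊔ PointedCone.hull ℝ {intVec u}) ∧
        intVec n ∈ addCone B (Q ⊔ PointedCone.hull ℝ {-intVec u}) := by
      rw [h1, h2]
      constructor
      · exact fun h => ⟨⟨0, le_rfl, by simpa using h⟩, ⟨0, le_rfl, by simpa using h⟩⟩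
      · rintro ⟨⟨s, hs, hs'⟩, t, ht, ht'⟩
        rcases hs.eq_or_lt with rfl | hs
        · simpa using hs'
        · convert hPc hs' ht' (a := t / (s + t)) (b := s / (s + t)) (by positivity) (by positivity)
            (by rw [← add_div, add_comm, div_self (by positivity)]) using 1
          match_scalars <;> field_simp
          all_goals ring
    have huni : intVec n ∈ X ↔ intVec n ∈ addCone B (Q ⊔ PointedCone.hull ℝ {intVec u}) ∨
        intVec n ∈ addCone B (Q ⊔ PointedCone.hull ℝ {-intVec u}) := by
      rw [h1, h2]
      constructor
      · rintro ⟨t, ht⟩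
        rcases le_total 0 t with h | h
        · exact Or.inl ⟨t, h, ht⟩
        · exact Or.inr ⟨-t, neg_nonneg.2 h, by rwa [neg_smul, ← sub_eq_add_neg]⟩
      · rintro (⟨t, -, ht⟩ | ⟨t, -, ht⟩)
        · exact ⟨t, ht⟩
        · exact ⟨-t, by rwa [neg_smul, sub_neg_eq_add]⟩
    simp only [Pi.sub_apply, Pi.neg_apply, indicatorSeries, Set.indicator_apply, Set.mem_preimage,
      Pi.one_apply, hint, huni]
    by_cases a : intVec n ∈ addCone B (Q ⊔ PointedCone.hull ℝ {intVec u}) <;>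
    by_cases b : intVec n ∈ addCone B (Q ⊔ PointedCone.hull ℝ {-intVec u}) <;> simp [a, b]
  rw [key]
  exact neg_mem hXt

theorem exists_sub_mem_of_total {E : Finset (Fin d → ℤ)} (hE : E.Nonempty)
    {Q : PointedCone ℝ (Fin d → ℝ)}
    (h : ∀ v ∈ E, ∀ w ∈ E, intVec v - intVec w ∈ Q ∨ intVec w - intVec v ∈ Q) :
    ∃ v ∈ E, ∀ w ∈ E, intVec w - intVec v ∈ Q := by
  classical
  induction hE using Finset.Nonempty.cons_induction with
  | singleton a => exact ⟨a, by simp, by simp⟩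
  | cons a s ha hs ih =>
    obtain ⟨v, hv, hmin⟩ := ih fun v hv w hw =>
      h v (Finset.mem_cons_of_mem hv) w (Finset.mem_cons_of_mem hw)
    rcases h v (Finset.mem_cons_of_mem hv) a (Finset.mem_cons_self a s) with h1 | h1
    · refine ⟨a, Finset.mem_cons_self a s, fun w hw => ?_⟩
      rcases Finset.mem_cons.1 hw with rfl | hw
      · simp
      · simpa using add_mem (hmin w hw) h1
    · refine ⟨v, Finset.mem_cons_of_mem hv, fun w hw => ?_⟩
      rcases Finset.mem_cons.1 hw with rfl | hw
      · exact h1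
      · exact hmin w hw

/-- The cone generated by the differences `w - v`, `w ∈ E`. -/
def coneAt (E : Finset (Fin d → ℤ)) (v : Fin d → ℤ) : PointedCone ℝ (Fin d → ℝ) :=
  PointedCone.hull ℝ ((· - intVec v) '' (intVec '' (E : Set (Fin d → ℤ))))

theorem sub_mem_coneAt {E : Finset (Fin d → ℤ)} (v : Fin d → ℤ) {w : Fin d → ℤ} (hw : w ∈ E) :
    intVec w - intVec v ∈ coneAt E v :=
  PointedCone.subset_hull ⟨_, ⟨w, hw, rfl⟩, rfl⟩

/-- If the differences of the points of `E` are, up to sign, in `Q`, then `Q` defines a total preorder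
on `E`. If `v` is a least point, `conv E + Q = v + Q`, and for all `w ≠ v` in `E` the cone
`coneAt E w + Q` contains the line through `w - v`. -/
theorem brion_of_total (E : Finset (Fin d → ℤ)) (Q : PointedCone ℝ (Fin d → ℝ))
    (h : ∀ v ∈ E, ∀ w ∈ E, intVec v - intVec w ∈ Q ∨ intVec w - intVec v ∈ Q) :
    indicatorSeries (addCone (convexHull ℝ (intVec '' (E : Set (Fin d → ℤ)))) Q) -
      ∑ v ∈ E, indicatorSeries (addCone {intVec v} (coneAt E v ⊔ Q)) ∈ torsionSeries d := by
  classical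
  rcases E.eq_empty_or_nonempty with rfl | hE
  · have : addCone (∅ : Set (Fin d → ℝ)) Q = ∅ := by
      ext
      simp [addCone]
    have hz : indicatorSeries (∅ : Set (Fin d → ℝ)) = 0 := Set.indicator_empty _
    simp [this, hz]
  obtain ⟨v, hv, hmin⟩ := exists_sub_mem_of_total hE h
  have heq : addCone (convexHull ℝ (intVec '' (E : Set (Fin d → ℤ)))) Q =
      addCone {intVec v} (coneAt E v ⊔ Q) := by
    have hle : coneAt E v ≤ Q := by
      refine Submodule.span_le.2 ?_
      rintro _ ⟨_, ⟨w, hw, rfl⟩, rfl⟩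
      exact hmin w hw
    rw [sup_of_le_right hle]
    ext x
    constructor
    · rintro ⟨y, hy, hxy⟩
      refine ⟨intVec v, rfl, ?_⟩
      have hyQ : y ∈ addCone {intVec v} Q := by
        refine convexHull_min ?_ (convex_addCone (convex_singleton _) Q) hy
        rintro _ ⟨w, hw, rfl⟩
        exact ⟨_, rfl, hmin w hw⟩
      obtain ⟨_, rfl, hyv⟩ := hyQ
      simpa using add_mem hxy hyv
    · rintro ⟨_, rfl, hx⟩
      exact ⟨_, subset_convexHull ℝ _ ⟨v, hv, rfl⟩, hx⟩
  rw [← Finset.add_sum_erase E _ hv, heq, sub_add_cancel_left]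
  refine neg_mem (sum_mem fun w hw => ?_)
  obtain ⟨hwv, hw⟩ := Finset.mem_erase.1 hw
  refine indicatorSeries_addCone_mem_torsionSeries _ (sub_ne_zero.2 hwv) ?_ ?_
  · rw [intVec_sub]
    exact Submodule.mem_sup_right (hmin w hw)
  · rw [intVec_sub, neg_sub]
    exact Submodule.mem_sup_left (sub_mem_coneAt w hv)

/-- Brion's theorem, modulo torsion, for the sum of the convex hull of a finite set `E` of integer
points and an arbitrary cone `Q`. Splitting along the differences of the points of `E`, which only
enlarges `Q`, reduces it to the case that `Q` contains each of these differences up to sign; `S`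
is the set of the pairs whose differences have still to be treated. -/
theorem brion_mod_torsion_aux (E : Finset (Fin d → ℤ)) (S : Finset ((Fin d → ℤ) × (Fin d → ℤ))) :
    ∀ Q : PointedCone ℝ (Fin d → ℝ),
    (∀ v ∈ E, ∀ w ∈ E, (v, w) ∈ S ∨ intVec v - intVec w ∈ Q ∨ intVec w - intVec v ∈ Q) →
    indicatorSeries (addCone (convexHull ℝ (intVec '' (E : Set (Fin d → ℤ)))) Q) -
      ∑ v ∈ E, indicatorSeries (addCone {intVec v} (coneAt E v ⊔ Q)) ∈ torsionSeries d := by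
  classical
  induction S using Finset.induction_on with
  | empty => exact fun Q h => brion_of_total E Q fun v hv w hw =>
      (h v hv w hw).resolve_left (Finset.notMem_empty _)
  | insert p S _ ih =>
    intro Q h
    by_cases hp : p.1 = p.2
    · refine ih Q fun v hv w hw => ?_
      rcases h v hv w hw with h1 | h1
      · rcases Finset.mem_insert.1 h1 with rfl | h1
        · exact Or.inr (Or.inl (by simp_all))
        · exact Or.inl h1
      · exact Or.inr h1
    have hu : p.1 - p.2 ≠ 0 := sub_ne_zero.2 hp
    set u := p.1 - p.2 with hudef
    have hu' : intVec p.1 - intVec p.2 = intVec u := (intVec_sub _ _).symm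
    have ih1 := ih (Q ⊔ PointedCone.hull ℝ {intVec u}) fun v hv w hw => by
      rcases h v hv w hw with h1 | h1
      · rcases Finset.mem_insert.1 h1 with rfl | h1
        · exact Or.inr (Or.inl (hu' ▸ Submodule.mem_sup_right (PointedCone.subset_hull rfl)))
        · exact Or.inl h1
      · exact Or.inr (h1.imp (fun h => Submodule.mem_sup_left h) fun h => Submodule.mem_sup_left h)
    have ih2 := ih (Q ⊔ PointedCone.hull ℝ {-intVec u}) fun v hv w hw => by
      rcases h v hv w hw with h1 | h1
      · rcases Finset.mem_insert.1 h1 with rfl | h1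
        · refine Or.inr (Or.inr ?_)
          rw [← neg_sub, hu']
          exact Submodule.mem_sup_right (PointedCone.subset_hull rfl)
        · exact Or.inl h1
      · exact Or.inr (h1.imp (fun h => Submodule.mem_sup_left h) fun h => Submodule.mem_sup_left h)
    have h1 := indicatorSeries_addCone_split
      (convex_convexHull ℝ (intVec '' (E : Set (Fin d → ℤ)))) Q hu
    have h2 := (torsionSeries d).sum_mem (t := E) fun v _ =>
      indicatorSeries_addCone_split (convex_singleton (intVec v)) (coneAt E v ⊔ Q) hu
    have := add_mem (add_mem (sub_mem h1 h2) ih1) ih2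
    simp only [sup_assoc, Finset.sum_sub_distrib] at this
    convert this using 1
    abel

theorem brion_mod_torsion (E : Finset (Fin d → ℤ)) (Q : PointedCone ℝ (Fin d → ℝ)) :
    indicatorSeries (addCone (convexHull ℝ (intVec '' (E : Set (Fin d → ℤ)))) Q) -
      ∑ v ∈ E, indicatorSeries (addCone {intVec v} (coneAt E v ⊔ Q)) ∈ torsionSeries d :=
  brion_mod_torsion_aux E (E ×ˢ E) Q fun _ hv _ hw => Or.inl (Finset.mk_mem_product hv hw)

end Brion

/-! ### The generating function of a coconvex polytope -/

section Assembly
variable {d : ℕ}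

theorem sumsTo_indicatorSeries_addCone_singleton {K : PointedCone ℝ (Fin d → ℝ)} {r : RatFun d}
    (h : HasGenFun (K : Set (Fin d → ℝ)) r) (v : Fin d → ℤ) :
    SumsTo (indicatorSeries (addCone {intVec v} K)) (mono v * r) := by
  classical
  convert SumsTo.shift h v using 1
  funext n
  simp [indicatorSeries, Set.indicator_apply, addCone, intVec_sub]

theorem exists_hasGenFun_coneAt_sup {C : PointedCone ℝ (Fin d → ℝ)} (hC : IsIntegerCone C)
    (E : Finset (Fin d → ℤ)) (v : Fin d → ℤ) :
    ∃ r, HasGenFun ((coneAt E v ⊔ C : PointedCone ℝ (Fin d → ℝ)) : Set (Fin d → ℝ)) r := by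
  classical
  obtain ⟨s, rfl⟩ := hC
  have h := exists_hasGenFun_hull (E.image (· - v) ∪ s)
  have himg : intVec '' ((fun w => w - v) '' (E : Set (Fin d → ℤ))) =
      (· - intVec v) '' (intVec '' (E : Set (Fin d → ℤ))) := by
    rw [Set.image_image, Set.image_image]
    simp only [intVec_sub]
  rw [Finset.coe_union, Finset.coe_image, Set.image_union, himg] at h
  simpa only [PointedCone.hull, Submodule.span_union, coneAt] using h

end Assembly

end Coconvex

end

theorem theoremC {d : ℕ} (C : PointedCone ℝ (Fin d → ℝ))
    (hC_closed : IsClosed (C : Set (Fin d → ℝ)))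
    (hC_strict : (C : ConvexCone ℝ (Fin d → ℝ)).Salient)
    (hC_int : (interior (C : Set (Fin d → ℝ))).Nonempty)
    (hC : Coconvex.IsIntegerCone C)
    (A : Set (Fin d → ℝ)) (hA : Coconvex.IsCoconvexIntegerPolytope C A) :
    -- the vertices of `A` other than `0` form a finite set `V` of integer points
    ∃ V : Finset (Fin d → ℤ),
      Coconvex.intVec '' (V : Set (Fin d → ℤ)) = Coconvex.vert A \ {0} ∧
      -- the cone `C'_a` coincides with the closure of `C \ A`, shifted by `-a`, near `0`
      (∀ a ∈ V, ∀ᶠ v in 𝓝 (0 : Fin d → ℝ),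
        v ∈ Coconvex.tangentCone (closure ((C : Set (Fin d → ℝ)) \ A)) (Coconvex.intVec a) ↔
          Coconvex.intVec a + v ∈ closure ((C : Set (Fin d → ℝ)) \ A)) ∧
      -- the generating functions of `A`, of `C` and of all `C'_a` are well-defined
      (∃ r, Coconvex.HasGenFun A r) ∧
      (∃ r, Coconvex.HasGenFun (C : Set (Fin d → ℝ)) r) ∧
      (∀ a ∈ V, ∃ r, Coconvex.HasGenFun
        (Coconvex.tangentCone (closure ((C : Set (Fin d → ℝ)) \ A)) (Coconvex.intVec a)) r) ∧
      -- the formula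
      Coconvex.genFun A =
        -(∑ a ∈ V, Coconvex.mono a * Coconvex.genFun
          (Coconvex.tangentCone (closure ((C : Set (Fin d → ℝ)) \ A)) (Coconvex.intVec a)))
          + Coconvex.genFun (C : Set (Fin d → ℝ)) - 1 := by
  classical
  open Coconvex in
  obtain ⟨Δ, hΔC, hcl, hconv, hbdd, hne, hext, rfl⟩ := hA
  have hC' := hC
  obtain ⟨s, hs⟩ := hC
  have h0 := zero_notMem_of_isBounded_diff hΔC hconv hbdd hne
  have hadd : ∀ x ∈ Δ, ∀ c ∈ C, x + c ∈ Δ := fun x hx c hc =>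
    add_mem_of_isBounded_diff hΔC hconv hbdd hx hc
  -- the extreme points of `Δ` are integer points of the bounded set `closure (C \ Δ)`
  have hfin : (intVec ⁻¹' Δ.extremePoints ℝ).Finite :=
    finite_preimage_intVec <| hbdd.closure.subset fun e he =>
      mem_closure_diff_of_mem_extremePoints hΔC h0 he
  set E : Finset (Fin d → ℤ) := hfin.toFinset with hE
  have hEmem : ∀ a, a ∈ E ↔ intVec a ∈ Δ.extremePoints ℝ := fun a => by simp [hE]
  have hEΔ : ∀ a ∈ E, intVec a ∈ Δ := fun a ha => ((hEmem a).1 ha).1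
  have hEext : intVec '' (E : Set (Fin d → ℤ)) = Δ.extremePoints ℝ := by
    rw [hE, Set.Finite.coe_toFinset, Set.image_preimage_eq_of_subset hext]
  have hdec : ∀ x ∈ Δ, ∃ y ∈ convexHull ℝ (intVec '' (E : Set (Fin d → ℤ))), x - y ∈ C :=
    fun x hx => by
      simpa using exists_mem_convexHull_extremePoints hC_closed hC_strict (s := s.image intVec)
        (by rw [hs, Finset.coe_image]) hΔC hcl (E := E.image intVec)
        (by rw [Finset.coe_image, hEext]) hx
  have hΔeq : Δ = addCone (convexHull ℝ (intVec '' (E : Set (Fin d → ℤ)))) C := by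
    refine Set.Subset.antisymm hdec ?_
    rintro x ⟨y, hy, hxy⟩
    have hyΔ : y ∈ Δ := convexHull_min (hEext ▸ extremePoints_subset) hconv hy
    simpa using hadd y hyΔ _ hxy
  -- descriptions of `C` and `Δ` by inequalities
  obtain ⟨L₀, hL₀⟩ := exists_dual_hull (s.image intVec)
  rw [Finset.coe_image, ← hs] at hL₀
  obtain ⟨L, hL⟩ := exists_dual_convexHull_add_hull (E.image intVec) (s.image intVec)
  rw [Finset.coe_image, Finset.coe_image, ← hs] at hL
  have hLΔ : ∀ x, x ∈ Δ ↔ ∀ l ∈ L, 0 ≤ l.1 x + l.2 := fun x => by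
    rw [← hL]
    exact Set.ext_iff.1 hΔeq x
  have hLC : ∀ x, x ∈ C ↔ ∀ l ∈ L₀.image (fun l => (l, (0 : ℝ))), 0 ≤ l.1 x + l.2 := fun x => by
    rw [hL₀]
    simp
  have hdiff : closure ((C : Set (Fin d → ℝ)) \ ((C : Set (Fin d → ℝ)) \ (Δ ∪ {0}))) =
      insert 0 Δ := by
    rw [Set.sdiff_sdiff_right_self, Set.union_singleton, Set.inter_eq_right.2
      (Set.insert_subset (zero_mem C) hΔC), Set.insert_eq,
      (isClosed_singleton.union hcl).closure_eq]
  rw [hdiff]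
  have htan : ∀ a ∈ E, tangentCone (insert 0 Δ) (intVec a) =
      ((coneAt E a ⊔ C : PointedCone ℝ (Fin d → ℝ)) : Set (Fin d → ℝ)) := fun a ha => by
    rw [tangentCone_insert_zero_eq hconv (hEΔ a ha) h0]
    ext v
    exact exists_pos_add_smul_mem_iff hconv hadd (hEext ▸ extremePoints_subset) hdec (hEΔ a ha) v
  have hGtan : ∀ a ∈ E, ∃ r, HasGenFun (tangentCone (insert 0 Δ) (intVec a)) r := fun a ha => by
    rw [htan a ha]
    exact exists_hasGenFun_coneAt_sup hC' E a
  have hGC : HasGenFun (C : Set (Fin d → ℝ)) (genFun (C : Set (Fin d → ℝ))) := by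
    obtain ⟨r, hr⟩ := exists_hasGenFun_hull s
    rw [← hs] at hr
    rwa [hr.genFun_eq]
  have hGΔ : SumsTo (indicatorSeries Δ)
      (∑ a ∈ E, mono a * genFun (tangentCone (insert 0 Δ) (intVec a))) := by
    have hsum : SumsTo (∑ a ∈ E, indicatorSeries (addCone {intVec a} (coneAt E a ⊔ C)))
        (∑ a ∈ E, mono a * genFun (tangentCone (insert 0 Δ) (intVec a))) := by
      refine SumsTo.sum E fun a ha => sumsTo_indicatorSeries_addCone_singleton ?_ a
      obtain ⟨r, hr⟩ := hGtan a ha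
      rw [hr.genFun_eq]
      rwa [htan a ha] at hr
    refine hsum.of_sub_mem ?_
    have := brion_mod_torsion E C
    rwa [← hΔeq] at this
  have hGA : HasGenFun ((C : Set (Fin d → ℝ)) \ (Δ ∪ {0}))
      (genFun (C : Set (Fin d → ℝ)) -
        (∑ a ∈ E, mono a * genFun (tangentCone (insert 0 Δ) (intVec a))) - 1) := by
    have hser : indicatorSeries ((C : Set (Fin d → ℝ)) \ (Δ ∪ {0})) =
        indicatorSeries (C : Set (Fin d → ℝ)) - indicatorSeries Δ - indicatorSeries {0} := by
      funext n
      simp only [indicatorSeries, Set.indicator_apply, Set.mem_preimage, Pi.sub_apply,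
        Pi.one_apply, Set.mem_sdiff, Set.mem_union, Set.mem_singleton_iff]
      by_cases hn0 : intVec n = 0
      · simp [hn0, h0]
      · by_cases hnΔ : intVec n ∈ Δ
        · simp [hn0, hnΔ, show intVec n ∈ (C : Set (Fin d → ℝ)) from hΔC hnΔ]
        · simp [hn0, hnΔ]
    have h := (SumsTo.sub (f := indicatorSeries (C : Set (Fin d → ℝ))) hGC hGΔ).sub
      sumsTo_singleton_zero
    rw [← hser] at h
    exact h
  refine ⟨E, ?_, fun a ha => eventually_mem_tangentCone_iff hLΔ hconv (hEΔ a ha) h0, ⟨_, hGA⟩,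
    ⟨_, hGC⟩, hGtan, ?_⟩
  · rw [hEext]
    ext a
    rw [mem_extremePoints_iff_forall_not_locallyInvariant hLC (by simp) hC_closed hLΔ hΔC hcl h0
      rfl]
    exact ⟨fun h => ⟨h.2, h.1⟩, fun h => ⟨h.2, h.1⟩⟩
  · rw [hGA.genFun_eq]
    ring
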